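/- An adaptive user and an uncooperative user share a collision channel over slots $t=0,1,2,\dots$. Packets arrive to the uncooperative user's queue according to a Bernoulli process $A(0),A(1),\dots$ (i.i.d. with $P(A(t)=1)=\lambda=1-P(A(t)=0)$), where $\lambda\in(0,1)$. Let $Q(t)$ be its backlog just after the arrival $A(t)$; the queue is empty before slot $0$, so $Q(0)=A(0)$. The uncooperative user transmits one packet in every slot with $Q(t)>0$ (a packet may be transmitted in the slot in which it arrives). If only one of the two users transmits in a slot, its transmission succeeds; if both transmit, there is a collision and both transmissions fail. Thus $Q(t+1)=Q(t)-1+A(t+1)$ if $Q(t)>0$ and the adaptive user is silent in slot $t$, and $Q(t+1)=Q(t)+A(t+1)$ otherwise. At the end of each slot the controller of the adaptive user, which sees neither $A(t)$ nor $Q(t)$, is told whether the slot held a successful transmission, a collision, or was idle. Let $B(t)=1$ if $Q(t)=0$ and the adaptive user transmits in slot $t$, and $B(t)=0$ otherwise. For $p\in[0,1]$ let $\pi^{lb}_p$ be the randomized stationary policy that does not transmit in slot $t$ if slot $t-1$ was a collision, and otherwise transmits with probability $p$, the randomization being independent over slots and independent of the arrivals. **Theorem.** Let $$p^*=\begin{cases}1,&\lambda\le\frac13,\\[2pt]\dfrac{1-\lambda}{2\lambda},&\lambda>\frac13.\end{cases}$$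 Then $p^*\in[0,1]$, and under $\pi^{lb}_{p^*}$ the following limit exists and satisfies $$\mu^*_{lb}:=\lim_{T\to\infty}E\Big[\frac1T\sum_{t=0}^{T-1}B(t)\Big]=\begin{cases}1-2\lambda,&\lambda\le\frac13,\\[2pt]\dfrac{(1-\lambda)^2}{4\lambda},&\lambda>\frac13.\end{cases}$$ Moreover $p^*$ is optimal in this class of policies: for every $p\in[0,1]$ the corresponding limit under $\pi^{lb}_p$ exists and is at most $\mu^*_{lb}$. -/

import Mathlib

open MeasureTheory ProbabilityTheory Filter Topology

universe u

namespace CollisionChannel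

/-- The adaptive user's action in a slot: transmit or do not transmit. -/
inductive Action where
  | TR
  | NT

/-- The ternary feedback at the end of a slot. -/
inductive Feedback where
  | success
  | collision
  | idle

/-- Feedback as a function of the uncooperative user's backlog `Q(t)` and of the action `u(t)`.
The uncooperative user transmits exactly when its backlog is positive. -/
def feedback : ℕ → Action → Feedback
  | 0, .TR => .success
  | 0, .NT => .idle
  | _ + 1, .TR => .collision
  | _ + 1, .NT => .success

/-- Reward of a slot: `1` if the adaptive user transmits successfully, `0` otherwise. -/
def reward : ℕ → Action → ℝ
  | 0, .TR => 1
  | _, _ => 0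

/-- Uncooperative backlog at the end of a slot: one packet departs when the backlog is positive
and the adaptive user does not transmit; otherwise nothing departs. -/
def remaining : ℕ → Action → ℕ
  | q + 1, .NT => q
  | q, _ => q

/-- The controller's history `H(t)`: the actions and observations of the slots `0, …, t - 1`,
the most recent slot first. Its length is `t`. -/
abbrev History := List (Action × Feedback)

/-- A (randomized) policy: the probability of transmitting in slot `t` given the history `H(t)`.
The time `t` is the length of the history. -/
abbrev Policy := History → unitInterval

/-- The back-off policy: stay silent if the previous slot was a collision, and otherwise
transmit with probability `p`. -/
def backoffPolicy (p : unitInterval) : Policy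
  | (_, .collision) :: _ => 0
  | _ => p

/-- The action drawn by the policy from the history `h` with a random number `x`
(uniform on `[0, 1]`). -/
noncomputable def draw (π : Policy) (h : History) (x : ℝ) : Action :=
  if x < (π h : ℝ) then .TR else .NT

/-- The pair `(Q(t), H(t))` along the arrivals `a` and the policy's random numbers `x`. Here
`Q(t)` is the uncooperative user's backlog just after the arrival of slot `t`, and the
backlog is `0` before slot `0`. -/
noncomputable def state (π : Policy) (a : ℕ → Bool) (x : ℕ → ℝ) : ℕ → ℕ × History
  | 0 => ((a 0).toNat, [])
  | t + 1 =>
    let q := (state π a x t).1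
    let h := (state π a x t).2
    let v := draw π h (x t)
    (remaining q v + (a (t + 1)).toNat, (v, feedback q v) :: h)

/-- The reward process `B(t)`. -/
noncomputable def rewardAt (π : Policy) (a : ℕ → Bool) (x : ℕ → ℝ) (t : ℕ) : ℝ :=
  reward (state π a x t).1 (draw π (state π a x t).2 (x t))

/-- `A` is a Bernoulli process of rate `lam` (arrivals) and `U` is an independent sequence of
i.i.d. uniform random numbers (the randomization of the policy). -/
structure IsDriving {Ω : Type u} [MeasurableSpace Ω] (P : Measure Ω) (lam : ℝ)
    (A : ℕ → Ω → Bool) (U : ℕ → Ω → ℝ) : Prop where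
  measurable_arrival : ∀ t, Measurable (A t)
  measurable_uniform : ∀ t, Measurable (U t)
  law_arrival : ∀ t, P {ω | A t ω = true} = ENNReal.ofReal lam
  law_uniform : ∀ t, P.map (U t) = volume.restrict (Set.Icc (0 : ℝ) 1)
  indep_arrival : iIndepFun A P
  indep_uniform : iIndepFun U P
  indep : IndepFun (fun ω t => A t ω) (fun ω t => U t ω) P

/-- `E[(1 / T) ∑_{t < T} B(t)]`. -/
noncomputable def expectedThroughput {Ω : Type u} [MeasurableSpace Ω] (P : Measure Ω)
    (π : Policy) (A : ℕ → Ω → Bool) (U : ℕ → Ω → ℝ) (T : ℕ) : ℝ :=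
  ∫ ω, (1 / (T : ℝ)) *
    ∑ t ∈ Finset.range T, rewardAt π (fun s => A s ω) (fun s => U s ω) t ∂P

/-- With arrival rate `lam`, the policy `π` has long-run expected throughput `m` (the limit
exists and equals `m`), on whatever probability space the system is realized. -/
def HasThroughput (lam : ℝ) (π : Policy) (m : ℝ) : Prop :=
  ∀ (Ω : Type u) [MeasurableSpace Ω] (P : Measure Ω) [IsProbabilityMeasure P]
    (A : ℕ → Ω → Bool) (U : ℕ → Ω → ℝ), IsDriving P lam A U →
    Tendsto (expectedThroughput P π A U) atTop (𝓝 m)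

/-- The optimal transmission probability. -/
noncomputable def pStar (lam : ℝ) : ℝ :=
  if lam ≤ 1 / 3 then 1 else (1 - lam) / (2 * lam)

/-- The throughput at the optimal transmission probability. -/
noncomputable def muStar (lam : ℝ) : ℝ :=
  if lam ≤ 1 / 3 then 1 - 2 * lam else (1 - lam) ^ 2 / (4 * lam)

end CollisionChannel

/-! The back-off policy only remembers whether the last slot was a collision, so backlog and
collision flag form a Markov chain. Put `k = 1 / (1 + p)`. Lowering the backlog by `p / (1 + p)`
after a collision makes its mean drift equal to `lam - k` in every state with positive backlog, and
`lam` when the backlog is empty (`sum_potential_step`). Subtracting the linear growth `max 0 (lam -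
k) * t` gives a potential whose mean satisfies `m (t+1) = m t - max 0 (k - lam) + k * P(empty)`. The
centred drift never points away from zero and increments are bounded, so the second moment grows at
most linearly (`sum_potential_step_sq_le`) and the mean is `O(√t)`. Dividing the recursion by time,
the fraction of empty slots tends to `max 0 (k - lam) / k = max 0 (1 - lam * (1 + p))`; no
stationary law or ergodic theorem is needed. The throughput is `p` times this, and maximizing a
concave quadratic over `[0, 1]` finishes. -/

namespace CollisionChannel

/-! ### Reduction of the history to a chain on `ℕ × Bool`. -/

/-- One slot of the pair (backlog, whether the previous slot was a collision), given the next
arrival `a` and the outcome `b` of the coin toss of the adaptive user. -/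
def chainStep (z : ℕ × Bool) (a b : Bool) : ℕ × Bool :=
  ((if !z.2 && b then z.1 else z.1 - 1) + a.toNat, !z.2 && b && decide (0 < z.1))

/-- The pair (backlog, whether the previous slot was a collision) under the back-off policy. -/
noncomputable def chain (p : ℝ) (a : ℕ → Bool) (x : ℕ → ℝ) : ℕ → ℕ × Bool
  | 0 => ((a 0).toNat, false)
  | t + 1 => chainStep (chain p a x t) (a (t + 1)) (decide (x t < p))

/-- Whether the most recent slot of a history was a collision. -/
def lastCollision : History → Bool
  | (_, .collision) :: _ => true
  | _ => false

lemma backoffPolicy_eq (p : unitInterval) (h : History) :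
    backoffPolicy p h = if lastCollision h then 0 else p := by
  rcases h with _ | ⟨⟨_, _ | _ | _⟩, _⟩ <;> simp [backoffPolicy, lastCollision]

lemma draw_backoffPolicy (p : unitInterval) (h : History) {x : ℝ} (hx : 0 ≤ x) :
    draw (backoffPolicy p) h x =
      if (!lastCollision h && decide (x < (p : ℝ))) = true then .TR else .NT := by
  rw [draw, backoffPolicy_eq]
  cases lastCollision h <;> simp [hx]

lemma chain_eq (p : unitInterval) (a : ℕ → Bool) {x : ℕ → ℝ} (hx : ∀ t, 0 ≤ x t) (t : ℕ) :
    chain p a x t = ((state (backoffPolicy p) a x t).1,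
      lastCollision (state (backoffPolicy p) a x t).2) := by
  induction t with
  | zero => rfl
  | succ t ih =>
    rw [chain, ih, state]
    simp only [draw_backoffPolicy p _ (hx t)]
    generalize state (backoffPolicy p) a x t = s
    obtain ⟨q, h⟩ := s
    dsimp only
    generalize decide (x t < (p : ℝ)) = b
    cases lastCollision h <;> cases b <;> cases q <;>
      simp [chainStep, remaining, feedback, lastCollision]

/-- A collided packet stays in the queue. This excludes the state `(0, true)`, where the drift
formula and the reward formula would fail. -/
lemma chain_reachable (p : ℝ) (a : ℕ → Bool) (x : ℕ → ℝ) (t : ℕ) :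
    (chain p a x t).2 = true → 0 < (chain p a x t).1 := by
  induction t with
  | zero => simp [chain]
  | succ t ih =>
    rw [chain]
    generalize decide (x t < p) = b
    cases b <;> cases h : (chain p a x t).2 <;> simp_all [chainStep]

/-- Confines the state at each time to a finite set, so every real function of it is integrable. -/
lemma chain_le (p : ℝ) (a : ℕ → Bool) (x : ℕ → ℝ) (t : ℕ) : (chain p a x t).1 ≤ t + 1 := by
  induction t with
  | zero => simpa [chain] using Bool.toNat_le _
  | succ t ih =>
    have := Bool.toNat_le (a (t + 1))
    simp only [chain, chainStep]
    split_ifs <;> omega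

lemma rewardAt_eq (p : unitInterval) (a : ℕ → Bool) {x : ℕ → ℝ} (hx : ∀ t, 0 ≤ x t) (t : ℕ) :
    rewardAt (backoffPolicy p) a x t =
      if (chain p a x t).1 = 0 ∧ x t < (p : ℝ) then 1 else 0 := by
  have hr := chain_reachable p a x t
  rw [chain_eq p a hx t] at hr ⊢
  rw [rewardAt, draw_backoffPolicy p _ (hx t)]
  generalize state (backoffPolicy p) a x t = s at *
  obtain ⟨q, h⟩ := s
  dsimp only at *
  by_cases hp : x t < (p : ℝ) <;> cases hl : lastCollision h <;> cases q <;>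
    simp_all [reward]

lemma chain_congr (p : ℝ) {a a' : ℕ → Bool} {x x' : ℕ → ℝ} (t : ℕ)
    (ha : ∀ s ≤ t, a s = a' s) (hx : ∀ s < t, x s = x' s) : chain p a x t = chain p a' x' t := by
  induction t with
  | zero => simp [chain, ha 0 le_rfl]
  | succ t ih =>
    rw [chain, chain, ih (fun s hs => ha s (by omega)) (fun s hs => hx s (by omega)),
      ha _ le_rfl, hx t (by omega)]

lemma measurable_chain (p : ℝ) (t : ℕ) :
    Measurable (fun v : (ℕ → Bool) × (ℕ → ℝ) => chain p v.1 v.2 t) := by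
  induction t with
  | zero =>
    have h : Measurable (fun b : Bool => ((b.toNat, false) : ℕ × Bool)) := measurable_of_countable _
    exact h.comp ((measurable_pi_apply 0).comp measurable_fst)
  | succ t ih =>
    have h : Measurable (fun v : (ℕ × Bool) × Bool × Bool => chainStep v.1 v.2.1 v.2.2) :=
      measurable_of_countable _
    refine h.comp (ih.prodMk (((measurable_pi_apply (t + 1)).comp measurable_fst).prodMk ?_))
    refine measurable_to_bool ?_
    have : MeasurableSet {v : (ℕ → Bool) × (ℕ → ℝ) | v.2 t < p} :=
      measurableSet_lt ((measurable_pi_apply t).comp measurable_snd) measurable_const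
    convert this using 1
    ext v
    exact decide_eq_true_iff

end CollisionChannel

/-! ### Independence, and averaging over one slot. -/

/-- Interchanging the components of two independent pairs with independent components. -/
lemma ProbabilityTheory.IndepFun.prodMk_prodMk {Ω α₁ α₂ β₁ β₂ : Type*} [MeasurableSpace Ω]
    [MeasurableSpace α₁] [MeasurableSpace α₂] [MeasurableSpace β₁] [MeasurableSpace β₂]
    {P : Measure Ω} [IsProbabilityMeasure P] {X₁ : Ω → α₁} {X₂ : Ω → α₂} {Y₁ : Ω → β₁} {Y₂ : Ω → β₂}
    (hX₁ : Measurable X₁) (hX₂ : Measurable X₂) (hY₁ : Measurable Y₁) (hY₂ : Measurable Y₂)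
    (hX : IndepFun X₁ X₂ P) (hY : IndepFun Y₁ Y₂ P)
    (hXY : IndepFun (fun ω => (X₁ ω, X₂ ω)) (fun ω => (Y₁ ω, Y₂ ω)) P) :
    IndepFun (fun ω => (X₁ ω, Y₁ ω)) (fun ω => (X₂ ω, Y₂ ω)) P := by
  have h₁ : IndepFun X₁ Y₁ P := hXY.comp measurable_fst measurable_fst
  have h₂ : IndepFun X₂ Y₂ P := hXY.comp measurable_snd measurable_snd
  rw [indepFun_iff_map_prod_eq_prod_map_map (by fun_prop) (by fun_prop)] at *
  have := Measure.isProbabilityMeasure_map (μ := P) hX₁.aemeasurable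
  have := Measure.isProbabilityMeasure_map (μ := P) hX₂.aemeasurable
  have := Measure.isProbabilityMeasure_map (μ := P) hY₁.aemeasurable
  have := Measure.isProbabilityMeasure_map (μ := P) hY₂.aemeasurable
  set m₁ := P.map X₁
  set m₂ := P.map X₂
  set n₁ := P.map Y₁
  set n₂ := P.map Y₂
  -- The swap of the two middle factors of a fourfold product, composed of reassociations and one
  -- transposition.
  have e₁ := measurePreserving_prodAssoc m₁ m₂ (n₁.prod n₂)
  have e₂ := (MeasurePreserving.id m₁).prod ((measurePreserving_prodAssoc m₂ n₁ n₂).symm _)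
  have e₃ := (MeasurePreserving.id m₁).prod
    ((Measure.measurePreserving_swap (μ := m₂) (ν := n₁)).prod (MeasurePreserving.id n₂))
  have e₄ := (MeasurePreserving.id m₁).prod (measurePreserving_prodAssoc n₁ m₂ n₂)
  have e₅ := (measurePreserving_prodAssoc m₁ n₁ (m₂.prod n₂)).symm
  have e := (((e₅.comp e₄).comp e₃).comp e₂).comp e₁
  rw [h₁, h₂, ← e.map_eq, ← hX, ← hY, ← hXY, Measure.map_map e.measurable (by fun_prop)]
  rfl

namespace CollisionChannel

variable {Ω : Type u} [MeasurableSpace Ω] {P : Measure Ω} {lam : ℝ}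
  {A : ℕ → Ω → Bool} {U : ℕ → Ω → ℝ}

lemma IsDriving.ae_nonneg (h : IsDriving P lam A U) : ∀ᵐ ω ∂P, ∀ t, 0 ≤ U t ω := by
  refine ae_all_iff.2 fun t => ae_of_ae_map (h.measurable_uniform t).aemeasurable ?_
  rw [h.law_uniform t]
  filter_upwards [ae_restrict_mem measurableSet_Icc] with x hx using hx.1

lemma IsDriving.prob_lt (h : IsDriving P lam A U) (p : unitInterval) (t : ℕ) :
    P.real (U t ⁻¹' Set.Iio (p : ℝ)) = p := by
  rw [← map_measureReal_apply (h.measurable_uniform t) measurableSet_Iio, h.law_uniform t,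
    measureReal_restrict_apply measurableSet_Iio]
  have : Set.Iio (p : ℝ) ∩ Set.Icc 0 1 = Set.Ico 0 (p : ℝ) := by
    ext x
    have := p.2.2
    simp only [Set.mem_inter_iff, Set.mem_Iio, Set.mem_Icc, Set.mem_Ico]
    constructor
    · rintro ⟨h1, h2, -⟩
      exact ⟨h2, h1⟩
    · rintro ⟨h1, h2⟩
      exact ⟨h2, h1, by linarith⟩
  rw [this, Measure.real, Real.volume_Ico, sub_zero, ENNReal.toReal_ofReal p.2.1]

/-- The probability that a Bernoulli variable of parameter `r` takes the value `b`. -/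
def bernoulliWeight (r : ℝ) (b : Bool) : ℝ := if b then r else 1 - r

lemma measureReal_bool_eq [IsProbabilityMeasure P] {X : Ω → Bool} (hX : Measurable X) {r : ℝ}
    (hr : P.real (X ⁻¹' {true}) = r) (b : Bool) : P.real (X ⁻¹' {b}) = bernoulliWeight r b := by
  cases b
  · have : X ⁻¹' {false} = (X ⁻¹' {true})ᶜ := by
      ext ω
      simp
    rw [this, probReal_compl_eq_one_sub (hX (measurableSet_singleton _)), hr]
    simp [bernoulliWeight]
  · simpa [bernoulliWeight] using hr

lemma measurable_coin {X : Ω → ℝ} (hX : Measurable X) (p : ℝ) :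
    Measurable (fun ω => decide (X ω < p)) := by
  refine measurable_to_bool ?_
  have : MeasurableSet {ω | X ω < p} := measurableSet_lt hX measurable_const
  convert this using 1
  ext ω
  exact decide_eq_true_iff

lemma IsDriving.measurable_chain (h : IsDriving P lam A U) (p : ℝ) (t : ℕ) :
    Measurable (fun ω => chain p (fun s => A s ω) (fun s => U s ω) t) :=
  (CollisionChannel.measurable_chain p t).comp
    ((measurable_pi_lambda _ h.measurable_arrival).prodMk
      (measurable_pi_lambda _ h.measurable_uniform))

/-- The next arrival and the current random number are independent of the current state. -/
lemma IsDriving.indepFun_chain [IsProbabilityMeasure P] (h : IsDriving P lam A U) (p : ℝ) (t : ℕ) :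
    IndepFun (fun ω => chain p (fun s => A s ω) (fun s => U s ω) t)
      (fun ω => (A (t + 1) ω, decide (U t ω < p))) P := by
  have mA := h.measurable_arrival
  have mU := h.measurable_uniform
  have hA := h.indep_arrival.indepFun_finset (Finset.range (t + 1)) {t + 1} (by simp) mA
  have hU := h.indep_uniform.indepFun_finset (Finset.range t) {t} (by simp) mU
  have hAU : IndepFun (fun ω => ((fun i : Finset.range (t + 1) => A i ω),
      (fun i : ({t + 1} : Finset ℕ) => A i ω))) (fun ω => ((fun i : Finset.range t => U i ω),
      (fun i : ({t} : Finset ℕ) => U i ω))) P := by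
    refine h.indep.comp (φ := fun a => ((fun i : Finset.range (t + 1) => a i),
      (fun i : ({t + 1} : Finset ℕ) => a i))) (ψ := fun x => ((fun i : Finset.range t => x i),
      (fun i : ({t} : Finset ℕ) => x i))) ?_ ?_ <;> fun_prop
  have key := IndepFun.prodMk_prodMk (by fun_prop) (by fun_prop) (by fun_prop) (by fun_prop)
    hA hU hAU
  -- Finite tuples are padded to sequences; by `chain_congr` the padding does not affect the state
  -- at time `t`.
  have m₁ : Measurable (fun (v : Finset.range (t + 1) → Bool) (s : ℕ) =>
      if hs : s ∈ Finset.range (t + 1) then v ⟨s, hs⟩ else false) := by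
    refine measurable_pi_lambda _ fun s => ?_
    split_ifs with hs
    · exact measurable_pi_apply (⟨s, hs⟩ : Finset.range (t + 1))
    · exact measurable_const
  have m₂ : Measurable (fun (v : Finset.range t → ℝ) (s : ℕ) =>
      if hs : s ∈ Finset.range t then v ⟨s, hs⟩ else 0) := by
    refine measurable_pi_lambda _ fun s => ?_
    split_ifs with hs
    · exact measurable_pi_apply (⟨s, hs⟩ : Finset.range t)
    · exact measurable_const
  have mφ := (CollisionChannel.measurable_chain p t).comp
    ((m₁.comp measurable_fst).prodMk (m₂.comp measurable_snd))
  have mψ : Measurable (fun v : (({t + 1} : Finset ℕ) → Bool) × (({t} : Finset ℕ) → ℝ) =>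
      (v.1 ⟨t + 1, Finset.mem_singleton_self _⟩,
        decide (v.2 ⟨t, Finset.mem_singleton_self _⟩ < p))) :=
    ((measurable_pi_apply _).comp measurable_fst).prodMk
      (measurable_coin ((measurable_pi_apply _).comp measurable_snd) p)
  refine (key.comp mφ mψ).congr (Eventually.of_forall fun ω => ?_) (Eventually.of_forall fun _ => rfl)
  refine chain_congr p t (fun s hs => ?_) (fun s hs => ?_)
  · simp [hs]
  · simp [hs]

lemma IsDriving.integrable_chain [IsProbabilityMeasure P] (h : IsDriving P lam A U) (p : ℝ) (t : ℕ) (g : ℕ × Bool → ℝ) :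
    Integrable (fun ω => g (chain p (fun s => A s ω) (fun s => U s ω) t)) P := by
  refine Integrable.of_bound
    ((measurable_of_countable g).comp (h.measurable_chain p t)).aestronglyMeasurable
    (∑ z ∈ Finset.range (t + 2) ×ˢ Finset.univ, |g z|) (Eventually.of_forall fun ω => ?_)
  have := chain_le p (fun s => A s ω) (fun s => U s ω) t
  exact Finset.single_le_sum (f := fun z => |g z|) (fun _ _ => abs_nonneg _)
    (by simp only [Finset.mem_product, Finset.mem_range, Finset.mem_univ, and_true]; omega)

/-- The one-step expectation: the next arrival and the coin toss may be averaged out. -/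
lemma IsDriving.integral_step [IsProbabilityMeasure P] (h : IsDriving P lam A U) (hlam : 0 ≤ lam) (p : unitInterval) (t : ℕ)
    (g : ℕ × Bool → Bool → Bool → ℝ) :
    ∫ ω, g (chain p (fun s => A s ω) (fun s => U s ω) t) (A (t + 1) ω)
        (decide (U t ω < (p : ℝ))) ∂P =
      ∫ ω, ∑ v : Bool × Bool, bernoulliWeight lam v.1 * bernoulliWeight p v.2 *
        g (chain p (fun s => A s ω) (fun s => U s ω) t) v.1 v.2 ∂P := by
  set Z := fun ω => chain p (fun s => A s ω) (fun s => U s ω) t with hZ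
  set W := fun ω => (A (t + 1) ω, decide (U t ω < (p : ℝ))) with hW
  have mA := h.measurable_arrival (t + 1)
  have mU := measurable_coin (h.measurable_uniform t) p
  have mW : Measurable W := mA.prodMk mU
  have mZ : Measurable Z := h.measurable_chain p t
  have hind : IndepFun Z W P := h.indepFun_chain p t
  have hAU : IndepFun (A (t + 1)) (fun ω => decide (U t ω < (p : ℝ))) P :=
    h.indep.comp (φ := fun a : ℕ → Bool => a (t + 1))
      (ψ := fun x : ℕ → ℝ => decide (x t < (p : ℝ)))
      (measurable_pi_apply _) (measurable_coin (X := fun x : ℕ → ℝ => x t)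
        (measurable_pi_apply t) p)
  have hlaw (v : Bool × Bool) : ∫ ω, (if W ω = v then (1 : ℝ) else 0) ∂P =
      bernoulliWeight lam v.1 * bernoulliWeight p v.2 := by
    have e : (fun ω => if W ω = v then (1 : ℝ) else 0) =
        (A (t + 1) ⁻¹' {v.1} ∩ (fun ω => decide (U t ω < (p : ℝ))) ⁻¹' {v.2}).indicator 1 := by
      ext ω
      classical
      rw [Set.indicator_apply]
      simp [hW, Prod.ext_iff]
    have ms := measurableSet_singleton (α := Bool)
    rw [e, integral_indicator_one ((mA (ms _)).inter (mU (ms _))), Measure.real,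
      hAU.measure_inter_preimage_eq_mul _ _ (ms _) (ms _), ENNReal.toReal_mul]
    congr 1
    · refine measureReal_bool_eq mA ?_ _
      have := h.law_arrival (t + 1)
      rw [Measure.real]
      change (P {ω | A (t + 1) ω = true}).toReal = lam
      rw [this, ENNReal.toReal_ofReal hlam]
    · refine measureReal_bool_eq mU ?_ _
      convert h.prob_lt p t using 2
      ext ω
      exact decide_eq_true_iff
  have hint (v : Bool × Bool) : Integrable (fun ω => g (Z ω) v.1 v.2) P :=
    h.integrable_chain p t fun z => g z v.1 v.2
  -- Splitting over the four values of `W` leaves products of a function of `Z` and one of `W`,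
  -- which factor by independence.
  calc ∫ ω, g (Z ω) (A (t + 1) ω) (decide (U t ω < (p : ℝ))) ∂P
      = ∫ ω, ∑ v : Bool × Bool, g (Z ω) v.1 v.2 * (if W ω = v then 1 else 0) ∂P := by
        refine integral_congr_ae (Eventually.of_forall fun ω => ?_)
        simp [hW]
    _ = ∑ v : Bool × Bool, ∫ ω, g (Z ω) v.1 v.2 * (if W ω = v then 1 else 0) ∂P := by
        refine integral_finsetSum _ fun v _ => (hint v).mul_bdd (c := 1)
          ((measurable_of_countable fun w => if w = v then (1 : ℝ) else 0).comp
            mW).aestronglyMeasurable (Eventually.of_forall fun ω => ?_)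
        split_ifs <;> simp
    _ = ∑ v : Bool × Bool, ∫ ω, bernoulliWeight lam v.1 * bernoulliWeight p v.2 *
          g (Z ω) v.1 v.2 ∂P := by
        refine Finset.sum_congr rfl fun v _ => ?_
        rw [hind.integral_fun_comp_mul_comp (f := fun z => g z v.1 v.2)
          (g := fun w => if w = v then (1 : ℝ) else 0) mZ.aemeasurable mW.aemeasurable
          (measurable_of_countable _).aestronglyMeasurable
          (measurable_of_countable _).aestronglyMeasurable, hlaw, integral_const_mul, mul_comm]
    _ = _ := (integral_finsetSum _ fun v _ => (hint v).const_mul _).symm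

end CollisionChannel

namespace CollisionChannel

/-! ### Drift and second moment of the corrected backlog. -/

/-- The backlog, corrected for a preceding collision so that its drift is the same in all states
with positive backlog, and recentred when it grows linearly. -/
noncomputable def potential (lam p : ℝ) (t : ℕ) (z : ℕ × Bool) : ℝ :=
  z.1 - (if z.2 then p / (1 + p) else 0) - max 0 (lam - 1 / (1 + p)) * t

/-- The indicator of an empty backlog. -/
def emptyIndicator (z : ℕ × Bool) : ℝ := if z.1 = 0 then 1 else 0

lemma max_zero_sub_max_zero_neg (x : ℝ) : max 0 x - max 0 (-x) = x := by
  rcases le_total 0 x with h | h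
  · rw [max_eq_right h, max_eq_left (by linarith)]; ring
  · rw [max_eq_left h, max_eq_right (by linarith)]; ring

lemma sum_potential_step {lam p : ℝ} (hp : 0 ≤ p) (t : ℕ) {z : ℕ × Bool}
    (hz : z.2 = true → 0 < z.1) :
    ∑ v : Bool × Bool, bernoulliWeight lam v.1 * bernoulliWeight p v.2 *
        potential lam p (t + 1) (chainStep z v.1 v.2) =
      potential lam p t z - max 0 (1 / (1 + p) - lam) + 1 / (1 + p) * emptyIndicator z := by
  obtain ⟨q, c⟩ := z
  have hs := max_zero_sub_max_zero_neg (lam - 1 / (1 + p))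
  rw [neg_sub] at hs
  have hk : p / (1 + p) = 1 - 1 / (1 + p) := by field_simp; ring
  have hk' : p * (1 / (1 + p)) = 1 - 1 / (1 + p) := by field_simp; ring
  simp only [potential]
  rw [hk]
  generalize 1 / (1 + p) = k at *
  generalize max 0 (lam - k) = s at *
  generalize max 0 (k - lam) = r at *
  rcases q with _ | q
  · obtain rfl : c = false := by simpa using hz
    simp [Fintype.sum_prod_type, bernoulliWeight, chainStep, emptyIndicator]
    linear_combination -hs
  · cases c <;> simp [Fintype.sum_prod_type, bernoulliWeight, chainStep, emptyIndicator]
    · linear_combination hk' - hs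
    · linear_combination -hs

/-- Expanding the square about the current value leaves a nonpositive cross term plus the mean
squared increment. -/
lemma sum_potential_step_sq_le {lam p : ℝ} (hlam0 : 0 ≤ lam) (hlam1 : lam ≤ 1) (hp0 : 0 ≤ p)
    (hp1 : p ≤ 1) (t : ℕ) {z : ℕ × Bool} (hz : z.2 = true → 0 < z.1) :
    ∑ v : Bool × Bool, bernoulliWeight lam v.1 * bernoulliWeight p v.2 *
        potential lam p (t + 1) (chainStep z v.1 v.2) ^ 2 ≤ potential lam p t z ^ 2 + 4 := by
  obtain ⟨k, hk⟩ : ∃ k, k = 1 / (1 + p) := ⟨_, rfl⟩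
  have hk0 : 0 < k := by rw [hk]; positivity
  have hk1 : k ≤ 1 := by rw [hk, div_le_one (by linarith)]; linarith
  have hmean := sum_potential_step (lam := lam) hp0 t hz
  have hw : ∑ v : Bool × Bool, bernoulliWeight lam v.1 * bernoulliWeight p v.2 = 1 := by
    simp [Fintype.sum_prod_type, bernoulliWeight]; ring
  have hw0 (v : Bool × Bool) : 0 ≤ bernoulliWeight lam v.1 * bernoulliWeight p v.2 := by
    refine mul_nonneg ?_ ?_ <;> unfold bernoulliWeight <;> split_ifs <;> linarith
  have hd : p / (1 + p) = 1 - k := by rw [hk]; field_simp; ring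
  -- With an empty backlog the potential is `≤ 0` and the drift `≥ 0`. With a positive one the drift
  -- vanishes if `lam ≥ k`; otherwise there is no recentring, the potential is `≥ 0` and the drift
  -- `≤ 0`.
  have hcross : potential lam p t z * (1 / (1 + p) * emptyIndicator z - max 0 (1 / (1 + p) - lam))
      ≤ 0 := by
    obtain ⟨q, c⟩ := z
    simp only [potential, emptyIndicator, hd, ← hk]
    rcases q with _ | q
    · obtain rfl : c = false := by simpa using hz
      have h1 : 0 ≤ max 0 (lam - k) * t := by positivity
      have h2 : max 0 (k - lam) ≤ k := max_le hk0.le (by linarith)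
      simp
      nlinarith
    · have h2 : (0 : ℝ) ≤ q + 1 - (if c then 1 - k else 0) := by
        have : (0 : ℝ) ≤ q := q.cast_nonneg
        split_ifs <;> linarith
      rcases le_total k lam with h | h
      · simp [h]
      · have h3 : max 0 (lam - k) = 0 := max_eq_left (by linarith)
        rw [h3]
        have h4 := le_max_left 0 (k - lam)
        push_cast
        simp only [zero_mul, sub_zero, mul_zero, zero_sub]
        nlinarith
  have hinc (v : Bool × Bool) :
      (potential lam p (t + 1) (chainStep z v.1 v.2) - potential lam p t z) ^ 2 ≤ 4 := by
    have hs0 := le_max_left 0 (lam - k)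
    have hs1 : max 0 (lam - k) ≤ 1 := max_le zero_le_one (by linarith)
    obtain ⟨q, c⟩ := z
    obtain ⟨a, b⟩ := v
    simp only [potential, hd, ← hk]
    generalize max 0 (lam - k) = s at *
    rcases q with _ | q <;> cases c <;> cases a <;> cases b <;>
      simp [chainStep] at hz ⊢ <;> nlinarith
  have hexp : ∑ v : Bool × Bool, bernoulliWeight lam v.1 * bernoulliWeight p v.2 *
      potential lam p (t + 1) (chainStep z v.1 v.2) ^ 2 =
      ∑ v : Bool × Bool, bernoulliWeight lam v.1 * bernoulliWeight p v.2 *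
        (potential lam p (t + 1) (chainStep z v.1 v.2) - potential lam p t z) ^ 2 +
      2 * potential lam p t z * ∑ v : Bool × Bool, bernoulliWeight lam v.1 * bernoulliWeight p v.2 *
        potential lam p (t + 1) (chainStep z v.1 v.2) -
      potential lam p t z ^ 2 *
        ∑ v : Bool × Bool, bernoulliWeight lam v.1 * bernoulliWeight p v.2 := by
    rw [Finset.mul_sum, Finset.mul_sum, ← Finset.sum_add_distrib, ← Finset.sum_sub_distrib]
    exact Finset.sum_congr rfl fun v _ => by ring
  have hvar : ∑ v : Bool × Bool, bernoulliWeight lam v.1 * bernoulliWeight p v.2 *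
      (potential lam p (t + 1) (chainStep z v.1 v.2) - potential lam p t z) ^ 2 ≤ 4 := by
    calc _ ≤ ∑ v : Bool × Bool, bernoulliWeight lam v.1 * bernoulliWeight p v.2 * 4 :=
          Finset.sum_le_sum fun v _ => mul_le_mul_of_nonneg_left (hinc v) (hw0 v)
      _ = 4 := by rw [← Finset.sum_mul, hw, one_mul]
  rw [hexp, hmean, hw]
  nlinarith

/-! ### From the recursion to the long-run throughput. -/

/-- The Cesàro limit of the forcing term of a recursion whose solution is `O(√t)`. -/
lemma tendsto_average_of_recursion {m z : ℕ → ℝ} {r k : ℝ} (hk : k ≠ 0)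
    (hm : ∀ t, m t ^ 2 ≤ 4 * (t + 1)) (hrec : ∀ t, m (t + 1) = m t - r + k * z t) :
    Tendsto (fun T : ℕ => (1 / (T : ℝ)) * ∑ t ∈ Finset.range T, z t) atTop (𝓝 (r / k)) := by
  have hsum (T : ℕ) : m T = m 0 - r * T + k * ∑ t ∈ Finset.range T, z t := by
    induction T with
    | zero => simp
    | succ T ih => rw [hrec, ih, Finset.sum_range_succ]; push_cast; ring
  have hinv : Tendsto (fun T : ℕ => (1 : ℝ) / T) atTop (𝓝 0) := tendsto_one_div_atTop_nhds_zero_nat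
  have hsq : Tendsto (fun T : ℕ => (m T / T) ^ 2) atTop (𝓝 0) := by
    have hb : Tendsto (fun T : ℕ => 4 * ((1 : ℝ) / T) + 4 * ((1 : ℝ) / T) ^ 2) atTop (𝓝 0) := by
      simpa using (hinv.const_mul 4).add ((hinv.pow 2).const_mul 4)
    refine squeeze_zero' (Eventually.of_forall fun T => sq_nonneg _) ?_ hb
    filter_upwards [eventually_gt_atTop 0] with T hT
    have hT' : (0 : ℝ) < T := by exact_mod_cast hT
    have e : 4 * ((1 : ℝ) / T) + 4 * ((1 : ℝ) / T) ^ 2 = 4 * (T + 1) / T ^ 2 := by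
      field_simp
    rw [e, div_pow]
    gcongr
    exact hm T
  have hm0 : Tendsto (fun T : ℕ => m T / T) atTop (𝓝 0) := by
    rw [tendsto_zero_iff_abs_tendsto_zero]
    simpa [Function.comp_def, Real.sqrt_sq_eq_abs] using hsq.sqrt
  have hlim : Tendsto (fun T : ℕ => (m T / T - m 0 * (1 / T) + r) / k) atTop (𝓝 (r / k)) := by
    simpa using ((hm0.sub (hinv.const_mul (m 0))).add_const r).div_const k
  refine hlim.congr' ?_
  filter_upwards [eventually_gt_atTop 0] with T hT
  have hT' : (T : ℝ) ≠ 0 := by exact_mod_cast hT.ne'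
  rw [hsum T]
  field_simp
  ring

variable {Ω : Type u} [MeasurableSpace Ω] {P : Measure Ω} [IsProbabilityMeasure P] {lam : ℝ}
  {A : ℕ → Ω → Bool} {U : ℕ → Ω → ℝ}

lemma IsDriving.integral_potential_succ (h : IsDriving P lam A U) (hlam0 : 0 ≤ lam)
    (p : unitInterval) (t : ℕ) :
    ∫ ω, potential lam p (t + 1) (chain p (fun s => A s ω) (fun s => U s ω) (t + 1)) ∂P =
      ∫ ω, potential lam p t (chain p (fun s => A s ω) (fun s => U s ω) t) ∂P -
        max 0 (1 / (1 + (p : ℝ)) - lam) + 1 / (1 + (p : ℝ)) *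
        ∫ ω, emptyIndicator (chain p (fun s => A s ω) (fun s => U s ω) t) ∂P := by
  have key := h.integral_step hlam0 p t fun z a b => potential lam p (t + 1) (chainStep z a b)
  simp only [chain]
  rw [key]
  simp_rw [sum_potential_step p.2.1 t (chain_reachable _ _ _ _)]
  have hD := h.integrable_chain p t (potential lam p t)
  have hI := h.integrable_chain p t emptyIndicator
  have hD' : Integrable (fun ω => potential lam p t (chain p (fun s => A s ω) (fun s => U s ω) t) -
      max 0 (1 / (1 + (p : ℝ)) - lam)) P := hD.sub (integrable_const _)
  rw [integral_add hD' (hI.const_mul _), integral_sub hD (integrable_const _), integral_const_mul]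
  simp

lemma IsDriving.integral_potential_sq_le (h : IsDriving P lam A U) (hlam0 : 0 ≤ lam)
    (hlam1 : lam ≤ 1) (p : unitInterval) (t : ℕ) :
    ∫ ω, potential lam p t (chain p (fun s => A s ω) (fun s => U s ω) t) ^ 2 ∂P ≤
      4 * (t + 1) := by
  induction t with
  | zero =>
    have : ∀ ω, potential lam p 0 (chain p (fun s => A s ω) (fun s => U s ω) 0) ^ 2 ≤ 4 := by
      intro ω
      cases h : A 0 ω <;> simp [potential, chain, h]
    have := integral_mono (h.integrable_chain p 0 fun z => potential lam p 0 z ^ 2)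
      (integrable_const 4) this
    simpa using this
  | succ t ih =>
    have key := h.integral_step hlam0 p t
      fun z a b => potential lam p (t + 1) (chainStep z a b) ^ 2
    have hD := h.integrable_chain p t fun z => potential lam p t z ^ 2
    have hle := integral_mono (h.integrable_chain p t fun z =>
        ∑ v : Bool × Bool, bernoulliWeight lam v.1 * bernoulliWeight p v.2 *
          potential lam p (t + 1) (chainStep z v.1 v.2) ^ 2)
      (hD.add (integrable_const (4 : ℝ))) fun ω =>
        sum_potential_step_sq_le hlam0 hlam1 p.2.1 p.2.2 t (chain_reachable p _ _ t)
    simp only [chain]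
    rw [key]
    refine hle.trans ?_
    simp only [Pi.add_apply]
    rw [integral_add hD (integrable_const _)]
    simp
    linarith

lemma sq_integral_le_integral_sq {X : Ω → ℝ} (hX : Integrable X P)
    (hX2 : Integrable (fun ω => X ω ^ 2) P) : (∫ ω, X ω ∂P) ^ 2 ≤ ∫ ω, X ω ^ 2 ∂P := by
  have := (even_two.convexOn_pow (𝕜 := ℝ)).map_integral_le (continuous_pow 2).continuousOn
    isClosed_univ (Eventually.of_forall fun ω => Set.mem_univ (X ω)) hX hX2
  exact this

/-- An empty backlog rules out back-off, so the reward is the empty indicator times an independent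
coin. Equality is only almost sure, since a back-off is silent only for nonnegative random numbers.
-/
lemma IsDriving.integral_rewardAt (h : IsDriving P lam A U) (hlam0 : 0 ≤ lam)
    (p : unitInterval) (t : ℕ) :
    Integrable (fun ω => rewardAt (backoffPolicy p) (fun s => A s ω) (fun s => U s ω) t) P ∧
    ∫ ω, rewardAt (backoffPolicy p) (fun s => A s ω) (fun s => U s ω) t ∂P =
      p * ∫ ω, emptyIndicator (chain p (fun s => A s ω) (fun s => U s ω) t) ∂P := by
  have hae : (fun ω => rewardAt (backoffPolicy p) (fun s => A s ω) (fun s => U s ω) t) =ᵐ[P]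
      fun ω => emptyIndicator (chain p (fun s => A s ω) (fun s => U s ω) t) *
        (if decide (U t ω < (p : ℝ)) = true then 1 else 0) := by
    filter_upwards [h.ae_nonneg] with ω hω
    rw [rewardAt_eq p _ hω]
    by_cases hb : U t ω < (p : ℝ) <;> simp [emptyIndicator, hb]
  constructor
  · refine Integrable.congr ?_ hae.symm
    refine (h.integrable_chain p t emptyIndicator).mul_bdd (c := 1)
      ((measurable_of_countable fun b : Bool => if b = true then (1 : ℝ) else 0).comp
        (measurable_coin (h.measurable_uniform t) p)).aestronglyMeasurable
      (Eventually.of_forall fun ω => ?_)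
    split_ifs <;> simp
  · rw [integral_congr_ae hae, h.integral_step hlam0 p t
      fun z _ b => emptyIndicator z * (if b = true then 1 else 0), ← integral_const_mul]
    refine integral_congr_ae (Eventually.of_forall fun ω => ?_)
    simp [Fintype.sum_prod_type, bernoulliWeight]
    ring

/-- The long-run expected throughput of the back-off policy. -/
theorem hasThroughput_backoffPolicy (hlam0 : 0 ≤ lam) (hlam1 : lam ≤ 1) (p : unitInterval) :
    HasThroughput.{u} lam (backoffPolicy p) (p * max 0 (1 - lam * (1 + p))) := by
  intro Ω _ P _ A U h
  have hp := p.2.1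
  have hk : 0 < 1 / (1 + (p : ℝ)) := by positivity
  have hlim := tendsto_average_of_recursion hk.ne'
    (fun t => (sq_integral_le_integral_sq (h.integrable_chain p t (potential lam p t))
      (h.integrable_chain p t fun z => potential lam p t z ^ 2)).trans
      (h.integral_potential_sq_le hlam0 hlam1 p t))
    (h.integral_potential_succ hlam0 p)
  have e : max 0 (1 / (1 + (p : ℝ)) - lam) / (1 / (1 + (p : ℝ))) =
      max 0 (1 - lam * (1 + p)) := by
    rw [div_div_eq_mul_div, div_one, max_mul_of_nonneg _ _ (by positivity)]
    congr 1
    · simp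
    · field_simp
  rw [e] at hlim
  refine (hlim.const_mul (p : ℝ)).congr fun T => ?_
  rw [expectedThroughput, integral_const_mul,
    integral_finsetSum _ fun t _ => (h.integral_rewardAt hlam0 p t).1]
  simp_rw [(h.integral_rewardAt hlam0 p _).2, ← Finset.mul_sum]
  ring

end CollisionChannel

/-! ### Optimization over the transmission probability. -/

theorem theorem1 (lam : ℝ) (hlam0 : 0 < lam) (hlam1 : lam < 1) :
    ∃ p : unitInterval, (p : ℝ) = CollisionChannel.pStar lam ∧
      CollisionChannel.HasThroughput.{u} lam (CollisionChannel.backoffPolicy p)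
        (CollisionChannel.muStar lam) ∧
      ∀ q : unitInterval, ∃ m : ℝ, m ≤ CollisionChannel.muStar lam ∧
        CollisionChannel.HasThroughput.{u} lam (CollisionChannel.backoffPolicy q) m := by
  have hmem : CollisionChannel.pStar lam ∈ Set.Icc (0 : ℝ) 1 := by
    unfold CollisionChannel.pStar
    split_ifs with h
    · simp
    · push Not at h
      exact ⟨div_nonneg (by linarith) (by linarith), by rw [div_le_one] <;> linarith⟩
  have hval : CollisionChannel.pStar lam * max 0 (1 - lam * (1 + CollisionChannel.pStar lam)) =
      CollisionChannel.muStar lam := by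
    unfold CollisionChannel.pStar CollisionChannel.muStar
    split_ifs with h
    · rw [max_eq_right (by linarith)]
      ring
    · have e : 1 - lam * (1 + (1 - lam) / (2 * lam)) = (1 - lam) / 2 := by
        field_simp
        ring
      rw [e, max_eq_right (by linarith)]
      field_simp
      ring
  have hle (q : unitInterval) :
      (q : ℝ) * max 0 (1 - lam * (1 + q)) ≤ CollisionChannel.muStar lam := by
    have hq0 := q.2.1
    have hq1 := q.2.2
    rw [mul_max_of_nonneg _ _ hq0, mul_zero]
    refine max_le (hval ▸ mul_nonneg hmem.1 (le_max_left _ _)) ?_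
    unfold CollisionChannel.muStar
    split_ifs with h
    -- The gap `1 - 2 * lam - q * (1 - lam * (1 + q))` factors as `(1 - q) * (1 - lam * (2 + q))`.
    · nlinarith [mul_nonneg (sub_nonneg.2 hq1) (show 0 ≤ 1 - lam * (2 + q) by nlinarith)]
    · rw [le_div_iff₀ (by linarith)]
      -- Completing the square: the gap, times `4 * lam`, is exactly this square.
      nlinarith [sq_nonneg (2 * lam * q - (1 - lam))]
  refine ⟨⟨_, hmem⟩, rfl, ?_, fun q => ⟨_, hle q,
    CollisionChannel.hasThroughput_backoffPolicy hlam0.le hlam1.le q⟩⟩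
  have := CollisionChannel.hasThroughput_backoffPolicy hlam0.le hlam1.le
    ⟨CollisionChannel.pStar lam, hmem⟩
  rwa [hval] at this
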